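/- **Setting.** Let $\mathcal X$ be a measurable space, $\mathcal Y$ a finite label set, $p_{XY}$ a probability distribution on $\mathcal X\times\mathcal Y$ with marginals $p_X,P_Y$, and $\mathcal U$ a representation space with reference measure $du$ (Lebesgue measure if $\mathcal U$ is continuous, counting measure if it is discrete) and $\mathrm{Vol}(\mathcal U)=\int_{\mathcal U}du$. Assume $P_Y(y_{\min}):=\min_{y}P_Y(y)>0$ and $1\le \mathrm{Vol}(\mathcal U)<\infty$. An encoder $q_{U|X}$ is a family of conditional densities (pdf or pmf) $q_{U|X}(\cdot|x)$ with respect to $du$; a decoder $Q_{\hat Y|U}$ assigns to each $u\in\mathcal U$ a pmf on $\mathcal Y$. Put $\ell(x,y)=\mathbb E_{q_{U|X}}[-\log Q_{\hat Y|U}(y|U)\mid X=x]$ and, for $\mathcal S_n=\{(x_i,y_i)\}_{i=1}^n$, $$\mathcal E_{\rm gap}(q_{U|X},Q_{\hat Y|U},\mathcal S_n)=\Big|\frac1n\sum_{i=1}^n\ell(x_i,y_i)-\mathbb E_{p_{XY}}[\ell(X,Y)]\Big| .$$ Mutual information is $\mathcal I(p_X;q_{U|X})=\mathbb E_{p_X}\big[\mathcal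 D(q_{U|X}(\cdot|X)\,\|\,q_U)\big]\in[0,\infty]$, where $q_U(u)=\mathbb E_{p_X}[q_{U|X}(u|X)]$ and $\mathcal D$ is the Kullback–Leibler divergence. For each natural number $K$ in a given set $\mathcal N$ (all $K$ for which a quantization has been chosen) and each $y\in\mathcal Y$, let $\mathcal K^{(y)}_1,\dots,\mathcal K^{(y)}_K$ be a measurable partition of $\mathcal X$ with centroids $x^{(1,y)},\dots,x^{(K,y)}\in\mathcal X$, and set $$\epsilon(K)=\sup_{k,\;y,\;x\in\mathcal K_k^{(y)}}\big|\ell(x,y)-\ell(x^{(k,y)},y)\big|,\qquad r(K)=\frac1{\min_{k,y}p_X(\mathcal K_k^{(y)})},$$ $$q_U^D(u)=\sum_{k=1}^K\sum_{y}q_{U|X}(u|x^{(k,y)})\,p_{XY}(\mathcal K_k^{(y)}\times\{y\}),\qquad Q^D_{Y|U}(y|u)=\frac{\sum_{k=1}^K q_{U|X}(u|x^{(k,y)})\,p_{XY}(\mathcal K_k^{(y)}\times\{y\})}{q_U^D(u)},$$ $$\mathcal D_{\rm HL}(K)=\mathcal D_{\rm HL}\big(Q^D_{Y|U}\|Q_{\hat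 Y|U}|q^D_U\big)=\sqrt{\tfrac12\,\mathbb E_{q_U^D}\Big[\sum_{y}\Big(\sqrt{Q_{\hat Y|U}(y|U)}-\sqrt{Q^D_{Y|U}(y|U)}\Big)^2\Big]} .$$ (Here $1/0=\infty$, $0\cdot\infty=0$.) **Theorem (information-theoretic bound).** Let $\delta\in(0,1)$. There is a sequence $R_n\ge0$ with $R_n=\mathcal O(\log n/n)$, not depending on the encoder, the decoder or the partitions, such that for every encoder–decoder pair $(q_{U|X},Q_{\hat Y|U})$ with $Q_{\hat Y|U}(y_{\min}|u_{\min}):=\inf_{y,u}Q_{\hat Y|U}(y|u)\ge\eta$ for some $\eta>0$, every choice of quantizations as above and every $n\ge1$, with probability at least $1-\delta$ over $n$ i.i.d. samples $\mathcal S_n$ from $p_{XY}$, $$\mathcal E_{\rm gap}(q_{U|X},Q_{\hat Y|U},\mathcal S_n)\le\inf_{K\in\mathcal N}\left\{2\epsilon(K)+A_\delta\sqrt{\mathcal I(p_X;q_{U|X})}\,\frac{\log n}{\sqrt n}\,r(K)+\frac{D_\delta\,\mathcal D_{\rm HL}(K)+C_\delta}{\sqrt n}\right\}+R_n ,$$ where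 $B_\delta=1+\sqrt{\log\frac{|\mathcal Y|+4}{\delta}}$, $A_\delta=\sqrt2\,B_\delta$, $C_\delta=2\,\mathrm{Vol}(\mathcal U)e^{-1}+B_\delta\sqrt{|\mathcal Y|}\log\frac{\mathrm{Vol}(\mathcal U)}{P_Y(y_{\min})}$ and $D_\delta=Q_{\hat Y|U}(y_{\min}|u_{\min})^{-1/4}\sqrt{8\frac{|\mathcal Y|+4}{\delta}}$. -/

import Mathlib

open MeasureTheory InformationTheory Filter Asymptotics
open scoped ENNReal NNReal

noncomputable section

namespace CrossEntropyGap

variable {X Y U : Type*} [MeasurableSpace X] [MeasurableSpace Y] [Fintype Y] [MeasurableSpace U]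

/-- A randomized encoder `q_{U|X}`, given by its conditional densities `u ↦ q(u|x)` with respect to
the reference measure `vol` on `U`: conditional pdf's when `vol` is Lebesgue measure on a region,
conditional pmf's when `vol` is counting measure. -/
structure Encoder (X : Type*) {U : Type*} [MeasurableSpace X] [MeasurableSpace U]
    (vol : Measure U) where
  dens : X → U → ℝ≥0
  measurable_dens : Measurable (Function.uncurry dens)
  lintegral_dens : ∀ x, ∫⁻ u, dens x u ∂vol = 1

/-- A soft decoder `Q_{Ŷ|U}`: for each `u`, a probability mass function `y ↦ Q(y|u)` on `Y`. -/
structure Decoder (U Y : Type*) [MeasurableSpace U] [Fintype Y] where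
  prob : U → Y → ℝ
  measurable_prob : ∀ y, Measurable fun u => prob u y
  prob_nonneg : ∀ u y, 0 ≤ prob u y
  sum_prob : ∀ u, ∑ y, prob u y = 1

/-- For each label `y`, a partition of `X` into `K` measurable cells `cell k y`, together with
their centroids `center k y`. -/
structure Quantization (X Y : Type*) [MeasurableSpace X] (K : ℕ) where
  cell : Fin K → Y → Set X
  center : Fin K → Y → X
  measurableSet_cell : ∀ k y, MeasurableSet (cell k y)
  iUnion_cell : ∀ y, ⋃ k, cell k y = Set.univ
  disjoint_cell : ∀ y, Pairwise fun i j => Disjoint (cell i y) (cell j y)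

variable {vol : Measure U}

/-- The conditional law `q_{U|X}(· | x)` of the representation. -/
def Encoder.law (q : Encoder X vol) (x : X) : Measure U :=
  vol.withDensity fun u => (q.dens x u : ℝ≥0∞)

/-- The law `q_U` of the representation when the input has law `μ`; its density is
`u ↦ ∫ q(u|x) dμ(x)`. -/
def Encoder.marginal (q : Encoder X vol) (μ : Measure X) : Measure U :=
  vol.withDensity fun u => ∫⁻ x, (q.dens x u : ℝ≥0∞) ∂μ

/-- The mutual information `I(μ; q_{U|X}) = D(q_{U|X} ‖ q_U | μ)`. -/
def mutualInfo (μ : Measure X) (q : Encoder X vol) : ℝ≥0∞ :=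
  ∫⁻ x, klDiv (q.law x) (q.marginal μ) ∂μ

/-- The cross-entropy loss `ℓ(x, y) = E[-log Q(y|U) | X = x]`. -/
def loss (q : Encoder X vol) (Q : Decoder U Y) (x : X) (y : Y) : ℝ :=
  ∫ u, -Real.log (Q.prob u y) ∂(q.law x)

/-- The expected risk. -/
def risk (P : Measure (X × Y)) (q : Encoder X vol) (Q : Decoder U Y) : ℝ :=
  ∫ z, loss q Q z.1 z.2 ∂P

/-- The testing risk on the data set `S`. -/
def empRisk (q : Encoder X vol) (Q : Decoder U Y) {n : ℕ} (S : Fin n → X × Y) : ℝ :=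
  (1 / (n : ℝ)) * ∑ i, loss q Q (S i).1 (S i).2

/-- The error gap. -/
def gap (P : Measure (X × Y)) (q : Encoder X vol) (Q : Decoder U Y) {n : ℕ}
    (S : Fin n → X × Y) : ℝ :=
  |empRisk q Q S - risk P q Q|

/-- The smallest class probability `P_Y(y_min)`. -/
def minClassProb (P : Measure (X × Y)) : ℝ :=
  ⨅ y, (P.map Prod.snd).real {y}

/-- The smallest decoder probability `Q(y_min|u_min) = inf_{y,u} Q(y|u)`. -/
def Decoder.minProb (Q : Decoder U Y) : ℝ :=
  ⨅ z : U × Y, Q.prob z.1 z.2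

/-- `ε(K)`: the largest variation of the loss between a point of a cell and the centroid. -/
def epsilonK (q : Encoder X vol) (Q : Decoder U Y) {K : ℕ} (c : Quantization X Y K) : ℝ :=
  sSup {a | ∃ k y, ∃ x ∈ c.cell k y, a = |loss q Q x y - loss q Q (c.center k y) y|}

/-- `r(K)`: the inverse of the smallest probability, under `p_X`, of a cell. -/
def rK (P : Measure (X × Y)) {K : ℕ} (c : Quantization X Y K) : ℝ≥0∞ :=
  (⨅ k, ⨅ y, P.map Prod.fst (c.cell k y))⁻¹

/-- The density `(u, y) ↦ ∑_k q(u|x^{(k,y)}) p_{XY}(cell k y × {y})` of `(U, Y)` under the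
quantized testing distribution. -/
def jointD (P : Measure (X × Y)) (q : Encoder X vol) {K : ℕ} (c : Quantization X Y K)
    (u : U) (y : Y) : ℝ :=
  ∑ k, (q.dens (c.center k y) u : ℝ) * P.real (c.cell k y ×ˢ {y})

/-- The density `q_U^D`. -/
def densD (P : Measure (X × Y)) (q : Encoder X vol) {K : ℕ} (c : Quantization X Y K)
    (u : U) : ℝ :=
  ∑ y, jointD P q c u y

/-- The induced decoder `Q^D_{Y|U}`. -/
def decoderD (P : Measure (X × Y)) (q : Encoder X vol) {K : ℕ} (c : Quantization X Y K)
    (u : U) (y : Y) : ℝ :=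
  jointD P q c u y / densD P q c u

/-- The conditional Hellinger distance between `Q^D_{Y|U}` and `Q_{Ŷ|U}` given `q_U^D`. -/
def hellinger (P : Measure (X × Y)) (q : Encoder X vol) (Q : Decoder U Y) {K : ℕ}
    (c : Quantization X Y K) : ℝ :=
  √(1 / 2 * ∫ u, ∑ y, (√(Q.prob u y) - √(decoderD P q c u y)) ^ 2
    ∂(vol.withDensity fun u => ENNReal.ofReal (densD P q c u)))

/-- The constant `B_δ`, with `m` the number of classes. -/
def constB (m : ℕ) (δ : ℝ) : ℝ :=
  1 + √(Real.log (((m : ℝ) + 4) / δ))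

/-- The constant `A_δ`. -/
def constA (m : ℕ) (δ : ℝ) : ℝ :=
  √2 * constB m δ

/-- The constant `C_δ`, with `v = Vol(U)` and `p = P_Y(y_min)`. -/
def constC (m : ℕ) (δ v p : ℝ) : ℝ :=
  2 * v * Real.exp (-1) + constB m δ * √(m : ℝ) * Real.log (v / p)

/-- The constant `D_δ`, with `s = Q(y_min|u_min)`. -/
def constD (m : ℕ) (δ s : ℝ) : ℝ :=
  s ^ (-(1 / 4 : ℝ)) * √(8 * (((m : ℝ) + 4) / δ))

/-- The four explicit terms of the bound, for one quantization. The value is `∞` when the mutual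
information is infinite. -/
def mainBound (P : Measure (X × Y)) (q : Encoder X vol) (Q : Decoder U Y) (δ : ℝ) (n : ℕ) {K : ℕ}
    (c : Quantization X Y K) : ℝ≥0∞ :=
  ENNReal.ofReal (2 * epsilonK q Q c)
    + ENNReal.ofReal (constA (Fintype.card Y) δ)
        * mutualInfo (P.map Prod.fst) q ^ (1 / 2 : ℝ)
        * ENNReal.ofReal (Real.log n / √(n : ℝ)) * rK P c
    + ENNReal.ofReal
        ((constD (Fintype.card Y) δ Q.minProb * hellinger P q Q c
          + constC (Fintype.card Y) δ (vol.real Set.univ) (minClassProb P)) / √(n : ℝ))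

end CrossEntropyGap

end

/-!
Replacing every input by the centroid of its cell changes the loss by at most `ε(K)`, hence the gap
by at most `2 ε(K)`. At the centroids the loss is the information content `E[-log Q^D(y|U)]` of the
label under the quantized posterior plus an excess, and both are functions of the pair
(cell, label). By Jensen, moments of such cell averages are at most moments over the quantized
law of `(U, Y)`, where the label has law `Q^D(·|u)` given `U = u`.

* The information content is nonnegative with `E[exp(-log Q^D)] ≤ |Y|` and variance at most
  `|Y| / 2 * log² |Y|`, so a Bernstein bound gives `C_δ / √n + O(1 / n)`; the variance bound comes
  from recentering `-log p`, which is needed only for two labels.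
* The square of the excess has mean at most `8 Q(y_min|u_min)^{-1/2}` times the squared Hellinger
  distance, since `p (log p - log r)² ≤ 4 r^{-1/2} (√r - √p)²` for `p ≤ 1`; Chebyshev then gives
  the term `D_δ D_HL / √n`.

For a fixed encoder and decoder the bad events of all quantizations are nested, so no union bound
over `K` is needed.
-/

namespace CrossEntropyGap

section InformationContent

lemma mul_sq_neg_log_le {p : ℝ} (hp : 0 ≤ p) (hp1 : p ≤ 1) :
    p * (-Real.log p) ^ 2 ≤ 4 * Real.exp (-1) ^ 2 := by
  rcases hp.eq_or_lt with rfl | hp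
  · simp only [zero_mul]; positivity
  -- With `p = exp (-2 t)` this is the square of `t * exp (-t) ≤ exp (-1)`.
  set t := -Real.log p / 2 with ht
  have ht0 : 0 ≤ t := div_nonneg (neg_nonneg.2 (Real.log_nonpos hp.le hp1)) zero_le_two
  have hlog : -Real.log p = 2 * t := by rw [ht]; ring
  have hexp : p = Real.exp (-t) ^ 2 := by
    rw [← Real.exp_nat_mul, show ((2 : ℕ) : ℝ) * -t = Real.log p by rw [ht]; push_cast; ring,
      Real.exp_log hp]
  have hle : t * Real.exp (-t) ≤ Real.exp (-1) := by
    calc t * Real.exp (-t) ≤ Real.exp (t - 1) * Real.exp (-t) := by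
          gcongr; linarith [Real.add_one_le_exp (t - 1)]
      _ = Real.exp (-1) := by rw [← Real.exp_add]; ring_nf
  calc p * (-Real.log p) ^ 2 = 4 * (t * Real.exp (-t)) ^ 2 := by rw [hlog, hexp]; ring
    _ ≤ 4 * Real.exp (-1) ^ 2 := by gcongr

lemma hasDerivAt_binary_second_moment (c : ℝ) {p : ℝ} (hp : 0 < p) (hp1 : p < 1) :
    HasDerivAt (fun p => p * (Real.log p + c) ^ 2 + (1 - p) * (Real.log (1 - p) + c) ^ 2)
      ((Real.log p - Real.log (1 - p)) * (Real.log (p * (1 - p)) + 2 * (c + 1))) p := by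
  have hq : 0 < 1 - p := by linarith
  have hleft : ∀ {x : ℝ}, 0 < x → HasDerivAt (fun x => x * (Real.log x + c) ^ 2)
      ((Real.log x + c) ^ 2 + 2 * (Real.log x + c)) x := fun {x} hx =>
    ((hasDerivAt_id' x).mul (((Real.hasDerivAt_log hx.ne').add_const c).pow 2)).congr_deriv
      (by simp only [Pi.pow_apply]; push_cast; field_simp)
  refine ((hleft hp).add ((hleft hq).comp p ((hasDerivAt_id' p).const_sub 1))).congr_deriv ?_
  rw [Real.log_mul hp.ne' hq.ne']
  ring

/-- The centre at which the second moment of the information content of a binary distribution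
`(p, 1 - p)` is critical at `p = 1 / 10`, which makes its maximum smaller than `log 2 ^ 2`. -/
noncomputable def binaryCenter : ℝ := Real.log (10 / 3) - 1

lemma binary_second_moment_le_one_tenth {p : ℝ} (hp : 0 < p) (hp2 : p ≤ 1 / 2) :
    p * (Real.log p + binaryCenter) ^ 2 + (1 - p) * (Real.log (1 - p) + binaryCenter) ^ 2
      ≤ 1 / 10 * (Real.log (1 / 10) + binaryCenter) ^ 2
        + (1 - 1 / 10) * (Real.log (1 - 1 / 10) + binaryCenter) ^ 2 := by
  have hderiv : ∀ {x : ℝ}, 0 < x → x < 1 → _ := hasDerivAt_binary_second_moment binaryCenter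
  have hcont : ∀ s ⊆ Set.Ioo (0 : ℝ) 1, ContinuousOn _ s := fun s hs x hx =>
    (hderiv (hs hx).1 (hs hx).2).continuousAt.continuousWithinAt
  have hfst : ∀ {x : ℝ}, 0 < x → x ≤ 1 / 2 → Real.log x - Real.log (1 - x) ≤ 0 :=
    fun hx hx2 => sub_nonpos.2 (Real.log_le_log hx (by linarith))
  have hcrit : 2 * (binaryCenter + 1) = -Real.log (1 / 10 * (1 - 1 / 10)) := by
    rw [binaryCenter, show (1 / 10 * (1 - 1 / 10) : ℝ) = ((10 / 3) ^ 2)⁻¹ by norm_num, Real.log_inv,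
      Real.log_pow]
    push_cast
    ring
  rcases le_total p (1 / 10) with h | h
  · refine monotoneOn_of_deriv_nonneg (convex_Ioc 0 (1 / 10)) (hcont _ fun x hx =>
      ⟨hx.1, by linarith [hx.2]⟩) (fun x hx => ?_) (fun x hx => ?_) ⟨hp, h⟩
      ⟨by norm_num, le_rfl⟩ h
    all_goals
      rw [interior_Ioc] at hx
      have hD := hderiv hx.1 (by linarith [hx.2])
    · exact hD.differentiableAt.differentiableWithinAt
    · have hmul : 0 < x * (1 - x) := mul_pos hx.1 (by linarith [hx.2])
      rw [hD.deriv, hcrit]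
      refine mul_nonneg_of_nonpos_of_nonpos (hfst hx.1 (by linarith [hx.2])) ?_
      linarith [Real.log_le_log hmul (show x * (1 - x) ≤ 1 / 10 * (1 - 1 / 10) by
        nlinarith [hx.2])]
  · refine antitoneOn_of_deriv_nonpos (convex_Icc (1 / 10) (1 / 2)) (hcont _ fun x hx =>
      ⟨by linarith [hx.1], by linarith [hx.2]⟩) (fun x hx => ?_) (fun x hx => ?_)
      ⟨le_rfl, by norm_num⟩ ⟨h, hp2⟩ h
    all_goals
      rw [interior_Icc] at hx
      have hx0 : 0 < x := by linarith [hx.1]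
      have hD := hderiv hx0 (by linarith [hx.2])
    · exact hD.differentiableAt.differentiableWithinAt
    · rw [hD.deriv, hcrit]
      refine mul_nonpos_of_nonpos_of_nonneg (hfst hx0 hx.2.le) ?_
      linarith [Real.log_le_log (by norm_num)
        (show 1 / 10 * (1 - 1 / 10) ≤ x * (1 - x) by nlinarith [hx.1, hx.2])]

lemma binary_second_moment_one_tenth_le :
    1 / 10 * (Real.log (1 / 10) + binaryCenter) ^ 2
      + (1 - 1 / 10) * (Real.log (1 - 1 / 10) + binaryCenter) ^ 2 ≤ Real.log 2 ^ 2 := by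
  have hp : Real.log (1 / 10) + binaryCenter = -Real.log 3 - 1 := by
    rw [binaryCenter, Real.log_div (by norm_num) (by norm_num),
      Real.log_div (by norm_num) (by norm_num), Real.log_one]
    ring
  have hq : Real.log (1 - 1 / 10) + binaryCenter = Real.log 3 - 1 := by
    rw [binaryCenter, show (1 - 1 / 10 : ℝ) = 3 ^ 2 / 10 by norm_num,
      Real.log_div (by norm_num) (by norm_num), Real.log_div (by norm_num) (by norm_num),
      Real.log_pow]
    push_cast
    ring
  rw [hp, hq]
  nlinarith [Real.log_three_gt_d9, Real.log_three_lt_d9, Real.log_two_gt_d9]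

lemma binary_second_moment_le {p q : ℝ} (hp : 0 ≤ p) (hpq : p ≤ q) (h1 : p + q = 1) :
    p * (-Real.log p - binaryCenter) ^ 2 + q * (-Real.log q - binaryCenter) ^ 2
      ≤ Real.log 2 ^ 2 := by
  simp only [← neg_add', neg_sq]
  obtain rfl : q = 1 - p := by linarith
  rcases hp.eq_or_lt with rfl | hp
  · have hc : binaryCenter = Real.log 2 + Real.log 5 - Real.log 3 - 1 := by
      rw [binaryCenter, show (10 : ℝ) = 2 * 5 by norm_num,
        Real.log_div (by norm_num) (by norm_num), Real.log_mul (by norm_num) (by norm_num)]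
    simp only [zero_mul, sub_zero, Real.log_one, zero_add, one_mul]
    refine sq_le_sq' ?_ ?_ <;> rw [hc] <;>
      linarith [Real.log_two_gt_d9, Real.log_three_gt_d9, Real.log_three_lt_d9,
        Real.log_five_gt_d9, Real.log_five_lt_d9]
  · exact (binary_second_moment_le_one_tenth hp (by linarith)).trans
      binary_second_moment_one_tenth_le

lemma sum_mul_sq_neg_log_le {Y : Type*} [Fintype Y] (hY : 3 ≤ Fintype.card Y) {p : Y → ℝ}
    (hp : ∀ y, 0 ≤ p y) (hs : ∑ y, p y = 1) :
    ∑ y, p y * (-Real.log (p y)) ^ 2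
      ≤ (Fintype.card Y : ℝ) / 2 * Real.log (Fintype.card Y) ^ 2 := by
  have hle : ∀ y, p y ≤ 1 := fun y =>
    hs ▸ Finset.single_le_sum (fun y _ => hp y) (Finset.mem_univ y)
  have hlog : 1.098 ≤ Real.log (Fintype.card Y) :=
    (by linarith [Real.log_three_gt_d9] : 1.098 ≤ Real.log 3).trans
      (Real.log_le_log (by norm_num) (by exact_mod_cast hY))
  have hexp : Real.exp (-1) ≤ 0.368 := by linarith [Real.exp_neg_one_lt_d9]
  calc ∑ y, p y * (-Real.log (p y)) ^ 2 ≤ ∑ _y : Y, 4 * Real.exp (-1) ^ 2 :=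
        Finset.sum_le_sum fun y _ => mul_sq_neg_log_le (hp y) (hle y)
    _ = (Fintype.card Y : ℝ) * (4 * Real.exp (-1) ^ 2) := by simp
    _ ≤ (Fintype.card Y : ℝ) * (4 * 0.368 ^ 2) := by gcongr
    _ ≤ (Fintype.card Y : ℝ) * (1.098 ^ 2 / 2) := by gcongr; norm_num
    _ ≤ (Fintype.card Y : ℝ) * (Real.log (Fintype.card Y) ^ 2 / 2) := by gcongr
    _ = (Fintype.card Y : ℝ) / 2 * Real.log (Fintype.card Y) ^ 2 := by ring

lemma exists_sum_mul_sq_neg_log_sub_le (Y : Type*) [Fintype Y] :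
    ∃ c : ℝ, ∀ p : Y → ℝ, (∀ y, 0 ≤ p y) → ∑ y, p y = 1 →
      ∑ y, p y * (-Real.log (p y) - c) ^ 2
        ≤ (Fintype.card Y : ℝ) / 2 * Real.log (Fintype.card Y) ^ 2 := by
  rcases isEmpty_or_nonempty Y with _ | _
  · exact ⟨0, fun p _ _ => by simp⟩
  obtain h1 | h2 | h3 : Fintype.card Y = 1 ∨ Fintype.card Y = 2 ∨ 3 ≤ Fintype.card Y := by
    have := Fintype.card_pos (α := Y)
    lia
  · obtain ⟨a, ha⟩ := Finset.card_eq_one.1 (Finset.card_univ.trans h1)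
    refine ⟨0, fun p _ hs => ?_⟩
    rw [ha, Finset.sum_singleton] at *
    simp [hs, h1]
  · classical
    obtain ⟨a, b, hab, huniv⟩ := Finset.card_eq_two.1 (Finset.card_univ.trans h2)
    refine ⟨binaryCenter, fun p hp hs => ?_⟩
    rw [huniv, Finset.sum_pair hab] at *
    rw [h2, Nat.cast_two, div_self two_ne_zero, one_mul]
    rcases le_total (p a) (p b) with h | h
    · exact binary_second_moment_le (hp a) h hs
    · rw [add_comm]
      exact binary_second_moment_le (hp b) h (by linarith)
  · exact ⟨0, fun p hp hs => by simpa only [sub_zero] using sum_mul_sq_neg_log_le h3 hp hs⟩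

lemma mul_exp_neg_log_le {p : ℝ} (hp : 0 ≤ p) : p * Real.exp (-Real.log p) ≤ 1 := by
  rcases hp.eq_or_lt with rfl | hp
  · simp
  · rw [Real.exp_neg, Real.exp_log hp, mul_inv_cancel₀ hp.ne']

lemma sq_log_sub_log_le {a b : ℝ} (ha : 0 < a) (hb : 0 < b) :
    (Real.log a - Real.log b) ^ 2 ≤ (a - b) ^ 2 / (a * b) := by
  set t := (Real.log a - Real.log b) / 2 with ht
  have hsinh : t ^ 2 ≤ Real.sinh t ^ 2 := by
    rw [sq_le_sq, Real.abs_sinh]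
    exact Real.self_le_sinh_iff.2 (abs_nonneg t)
  have hcosh : Real.cosh (2 * t) = (a / b + (a / b)⁻¹) / 2 := by
    rw [← Real.cosh_log (by positivity), Real.log_div ha.ne' hb.ne', ht]
    congr 1; ring
  calc (Real.log a - Real.log b) ^ 2 = 4 * t ^ 2 := by rw [ht]; ring
    _ ≤ 4 * Real.sinh t ^ 2 := by gcongr
    _ = 2 * (Real.cosh (2 * t) - 1) := by rw [Real.cosh_two_mul, Real.cosh_sq]; ring
    _ = (a - b) ^ 2 / (a * b) := by rw [hcosh]; field_simp; ring

lemma mul_sq_log_sub_log_le {p r s : ℝ} (hp : 0 ≤ p) (hp1 : p ≤ 1) (hs : 0 < s) (hr : s ≤ r) :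
    p * (Real.log p - Real.log r) ^ 2 ≤ 4 * (√s)⁻¹ * (√r - √p) ^ 2 := by
  have hr0 : 0 < r := hs.trans_le hr
  rcases hp.eq_or_lt with rfl | hp
  · rw [zero_mul]; positivity
  have hp0 : 0 < √p := Real.sqrt_pos.2 hp
  have hr' : 0 < √r := Real.sqrt_pos.2 hr0
  have hsr : √s ≤ √r := Real.sqrt_le_sqrt hr
  have hp1' : √p ≤ 1 := Real.sqrt_le_one.2 hp1
  calc p * (Real.log p - Real.log r) ^ 2
      = √p ^ 2 * (4 * (Real.log √p - Real.log √r) ^ 2) := by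
        rw [Real.sq_sqrt hp.le, Real.log_sqrt hp.le, Real.log_sqrt hr0.le]; ring
    _ ≤ √p ^ 2 * (4 * ((√p - √r) ^ 2 / (√p * √r))) := by
        gcongr; exact sq_log_sub_log_le hp0 hr'
    _ = 4 * (√p * (√r)⁻¹) * (√r - √p) ^ 2 := by field_simp; ring
    _ ≤ 4 * (1 * (√s)⁻¹) * (√r - √p) ^ 2 := by gcongr
    _ = 4 * (√s)⁻¹ * (√r - √p) ^ 2 := by rw [one_mul]

end InformationContent

section Concentration

open ProbabilityTheory

variable {Z : Type*} [MeasurableSpace Z] {μ : Measure Z} {f g : Z → ℝ} {n : ℕ}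

lemma exp_le_taylor_two (z : ℝ) :
    Real.exp z ≤ 1 + z + z ^ 2 / 2 + |z| ^ 3 * Real.exp |z| := by
  have h := Complex.norm_exp_sub_sum_le_norm_mul_exp (z : ℂ) 3
  have hcast : (Real.exp z : ℂ) - ∑ m ∈ Finset.range 3, (z : ℂ) ^ m / (m.factorial : ℂ)
      = ((Real.exp z - (1 + z + z ^ 2 / 2) : ℝ) : ℂ) := by
    simp [Finset.sum_range_succ]
  rw [Complex.norm_real, Real.norm_eq_abs, ← Complex.ofReal_exp, hcast, Complex.norm_real,
    Real.norm_eq_abs] at h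
  linarith [le_abs_self (Real.exp z - (1 + z + z ^ 2 / 2))]

lemma exp_mul_le_taylor_two {s : ℝ} (hs : |s| ≤ 1 / 2) (y : ℝ) :
    Real.exp (s * y) ≤ 1 + s * y + s ^ 2 / 2 * y ^ 2 + 48 * |s| ^ 3 * Real.exp |y| := by
  have hcube : |y| ^ 3 ≤ 48 * Real.exp (|y| / 2) := by
    have := Real.pow_div_factorial_le_exp (x := |y| / 2) (by positivity) 3
    norm_num [Nat.factorial] at this
    linarith
  have hexp : Real.exp |s * y| ≤ Real.exp (|y| / 2) := by
    rw [Real.exp_le_exp, abs_mul]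
    nlinarith [abs_nonneg y]
  have hrem : |s * y| ^ 3 * Real.exp |s * y| ≤ 48 * |s| ^ 3 * Real.exp |y| := by
    calc |s * y| ^ 3 * Real.exp |s * y|
        = |s| ^ 3 * (|y| ^ 3 * Real.exp |s * y|) := by rw [abs_mul]; ring
      _ ≤ |s| ^ 3 * (48 * Real.exp (|y| / 2) * Real.exp (|y| / 2)) := by gcongr
      _ = 48 * |s| ^ 3 * Real.exp |y| := by
        rw [mul_assoc, ← Real.exp_add, add_halves]; ring
  linarith [exp_le_taylor_two (s * y), mul_pow s y 2]

lemma integrable_exp_mul_of_integrable_exp_abs (hg : AEMeasurable g μ)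
    (hexp : Integrable (fun z => Real.exp |g z|) μ) {s : ℝ} (hs : |s| ≤ 1) :
    Integrable (fun z => Real.exp (s * g z)) μ := by
  refine hexp.mono' (by fun_prop) (ae_of_all _ fun z => ?_)
  rw [Real.norm_eq_abs, Real.abs_exp, Real.exp_le_exp]
  calc s * g z ≤ |s| * |g z| := (le_abs_self _).trans (abs_mul _ _).le
    _ ≤ |g z| := mul_le_of_le_one_left (abs_nonneg _) hs

lemma mgf_le_exp_of_integral_eq_zero [IsProbabilityMeasure μ] (hg : AEMeasurable g μ)
    (hmean : ∫ z, g z ∂μ = 0) (hexp : Integrable (fun z => Real.exp |g z|) μ) {s : ℝ}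
    (hs : |s| ≤ 1 / 2) :
    mgf g μ s
      ≤ Real.exp (s ^ 2 / 2 * ∫ z, g z ^ 2 ∂μ + 48 * |s| ^ 3 * ∫ z, Real.exp |g z| ∂μ) := by
  have hintexp := fun {t : ℝ} (ht : |t| ≤ 1) => integrable_exp_mul_of_integrable_exp_abs hg hexp ht
  have hpow : ∀ k : ℕ, Integrable (fun z => g z ^ k) μ := fun k =>
    integrable_pow_of_integrable_exp_mul one_ne_zero (hintexp (by simp)) (hintexp (by simp)) k
  have hint1 : Integrable (fun z => 1 + s * g z) μ :=
    (integrable_const _).add (by simpa using (hpow 1).const_mul s)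
  have hint2 : Integrable (fun z => 1 + s * g z + s ^ 2 / 2 * g z ^ 2) μ :=
    hint1.add ((hpow 2).const_mul _)
  calc mgf g μ s
      ≤ ∫ z, (1 + s * g z + s ^ 2 / 2 * g z ^ 2 + 48 * |s| ^ 3 * Real.exp |g z|) ∂μ :=
        integral_mono (hintexp (hs.trans (by norm_num))) (hint2.add (hexp.const_mul _)) fun z =>
          exp_mul_le_taylor_two hs _
    _ = s ^ 2 / 2 * ∫ z, g z ^ 2 ∂μ + 48 * |s| ^ 3 * ∫ z, Real.exp |g z| ∂μ + 1 := by
        rw [integral_add hint2 (hexp.const_mul _), integral_add hint1 ((hpow 2).const_mul _),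
          integral_add (integrable_const _) (by simpa using (hpow 1).const_mul s),
          integral_const_mul, integral_const_mul, integral_const_mul, hmean]
        simp only [integral_const, probReal_univ, smul_eq_mul]
        ring
    _ ≤ _ := Real.add_one_le_exp _

lemma measureReal_pi_le_sum_le [IsProbabilityMeasure μ] {t : ℝ} (ht : 0 ≤ t)
    (hint : Integrable (fun z => Real.exp (t * g z)) μ) (n : ℕ) (a : ℝ) :
    (Measure.pi fun _ : Fin n => μ).real {S | a ≤ ∑ i, g (S i)}
      ≤ Real.exp (-t * a) * mgf g μ t ^ n := by
  have hprod : ∀ S : Fin n → Z, Real.exp (t * ∑ i, g (S i)) = ∏ i, Real.exp (t * g (S i)) :=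
    fun S => by rw [Finset.mul_sum, Real.exp_sum]
  have hmgf : mgf (fun S : Fin n → Z => ∑ i, g (S i)) (Measure.pi fun _ => μ) t
      = mgf g μ t ^ n := by
    simp only [mgf, hprod]
    rw [integral_fintype_prod_eq_pow (fun z => Real.exp (t * g z)), Fintype.card_fin]
  rw [← hmgf]
  refine measure_ge_le_exp_mul_mgf a ht ?_
  simp only [hprod]
  exact Integrable.fintype_prod fun _ => hint

-- The optimal parameter for the quadratic term alone is `2 * L / (C * r)`; the shift by `4 * L`
-- keeps `s ≤ 1 / 2` for every `r`.
lemma exists_chernoff_parameter {C L M r : ℝ} (hC : 0 < C) (hL : 0 < L) (hM : 0 ≤ M)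
    (hr : 0 ≤ r) :
    ∃ s, 0 < s ∧ s ≤ 1 / 2 ∧
      L + r ^ 2 * (s ^ 2 / 2 * (C ^ 2 / (2 * L)) + 48 * s ^ 3 * M)
        ≤ s * (C * r + (2 * L + 192 * L ^ 2 * M / C ^ 2)) := by
  have hD : 0 < C * r + 4 * L := by positivity
  set s := 2 * L / (C * r + 4 * L)
  have hs0 : 0 < s := by positivity
  have hs : s ≤ 1 / 2 := by
    rw [div_le_iff₀ hD]
    nlinarith [mul_nonneg hC.le hr]
  have hquad : L + r ^ 2 * (s ^ 2 / 2 * (C ^ 2 / (2 * L))) ≤ s * (C * r + 2 * L) := by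
    have hdiff : s * (C * r + 2 * L) - (L + r ^ 2 * (s ^ 2 / 2 * (C ^ 2 / (2 * L))))
        = 4 * C * r * L ^ 2 / (C * r + 4 * L) ^ 2 := by
      simp only [s]
      field_simp
      ring
    have : 0 ≤ 4 * C * r * L ^ 2 / (C * r + 4 * L) ^ 2 := by positivity
    linarith
  have hcube : r ^ 2 * (48 * s ^ 3 * M) ≤ s * (192 * L ^ 2 * M / C ^ 2) := by
    have hsr : s * (C * r) ≤ 2 * L := by
      rw [div_mul_eq_mul_div, div_le_iff₀ hD]
      nlinarith [mul_pos hL hL]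
    calc r ^ 2 * (48 * s ^ 3 * M) = s * (48 * (s * (C * r)) ^ 2 * M / C ^ 2) := by
          field_simp
      _ ≤ s * (48 * (2 * L) ^ 2 * M / C ^ 2) := by gcongr
      _ = s * (192 * L ^ 2 * M / C ^ 2) := by ring
  exact ⟨s, hs0, hs, by linarith⟩

lemma measureReal_pi_bernstein_le [IsProbabilityMeasure μ] (hg : AEMeasurable g μ)
    (hmean : ∫ z, g z ∂μ = 0) (hexp : Integrable (fun z => Real.exp |g z|) μ) {C L M : ℝ}
    (hC : 0 < C) (hL : 0 < L) (hV : ∫ z, g z ^ 2 ∂μ ≤ C ^ 2 / (2 * L))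
    (hM : ∫ z, Real.exp |g z| ∂μ ≤ M) (n : ℕ) :
    (Measure.pi fun _ : Fin n => μ).real
        {S | C * √n + (2 * L + 192 * L ^ 2 * M / C ^ 2) ≤ ∑ i, g (S i)} ≤ Real.exp (-L) := by
  have hM0 : 0 ≤ M := (integral_nonneg fun z => (Real.exp_pos |g z|).le).trans hM
  obtain ⟨s, hs0, hs, hparam⟩ := exists_chernoff_parameter hC hL hM0 (Real.sqrt_nonneg (n : ℝ))
  have habs : |s| ≤ 1 / 2 := (abs_of_pos hs0).trans_le hs
  have hmgf : mgf g μ s ≤ Real.exp (s ^ 2 / 2 * (C ^ 2 / (2 * L)) + 48 * s ^ 3 * M) := by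
    refine (mgf_le_exp_of_integral_eq_zero hg hmean hexp habs).trans ?_
    rw [abs_of_pos hs0]
    gcongr
  refine (measureReal_pi_le_sum_le hs0.le
    (integrable_exp_mul_of_integrable_exp_abs hg hexp (habs.trans (by norm_num))) n _).trans ?_
  calc _ ≤ Real.exp (-s * (C * √n + (2 * L + 192 * L ^ 2 * M / C ^ 2)))
        * Real.exp (s ^ 2 / 2 * (C ^ 2 / (2 * L)) + 48 * s ^ 3 * M) ^ n := by
        gcongr
        exact mgf_nonneg
    _ ≤ Real.exp (-L) := by
        rw [← Real.exp_nat_mul, ← Real.exp_add, Real.exp_le_exp]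
        rw [Real.sq_sqrt n.cast_nonneg] at hparam
        linarith

/-- The deviation of the empirical mean of `f` over the sample `S` from the mean of `f` under
`μ`; the error gap is the deviation of the loss. -/
noncomputable def meanDeviation (μ : Measure Z) (f : Z → ℝ) (S : Fin n → Z) : ℝ :=
  |1 / (n : ℝ) * ∑ i, f (S i) - ∫ z, f z ∂μ|

lemma meanDeviation_add_le (hf : Integrable f μ) (hg : Integrable g μ) (S : Fin n → Z) :
    meanDeviation μ (f + g) S ≤ meanDeviation μ f S + meanDeviation μ g S := by
  unfold meanDeviation
  rw [integral_add' hf hg]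
  simp only [Pi.add_apply, Finset.sum_add_distrib, mul_add, add_sub_add_comm]
  exact abs_add_le _ _

lemma meanDeviation_le_of_abs_le [IsProbabilityMeasure μ] {b : ℝ} (hb : ∀ z, |f z| ≤ b)
    (hn : 0 < n) (S : Fin n → Z) : meanDeviation μ f S ≤ 2 * b := by
  have hn' : (0 : ℝ) < n := by exact_mod_cast hn
  have hemp : |1 / (n : ℝ) * ∑ i, f (S i)| ≤ b := by
    rw [abs_mul, abs_of_pos (by positivity), one_div, inv_mul_le_iff₀ hn']
    exact (Finset.abs_sum_le_sum_abs _ _).trans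
      ((Finset.sum_le_sum fun i _ => hb (S i)).trans (by simp))
  have hint : |∫ z, f z ∂μ| ≤ b := by
    simpa using norm_integral_le_of_norm_le_const (f := f) (ae_of_all μ hb)
  calc meanDeviation μ f S ≤ _ := abs_sub _ _
    _ ≤ 2 * b := by linarith

lemma meanDeviation_eq_abs_sum (hn : 0 < n) (S : Fin n → Z) :
    meanDeviation μ f S = |∑ i, (f (S i) - ∫ z, f z ∂μ)| / n := by
  have hn' : (0 : ℝ) < n := by exact_mod_cast hn
  rw [meanDeviation, ← abs_of_pos hn', ← abs_div, abs_of_pos hn', Finset.sum_sub_distrib,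
    Finset.sum_const, Finset.card_univ, Fintype.card_fin, nsmul_eq_mul]
  congr 1
  field_simp

lemma integrable_exp_abs_sub_integral (hf : Integrable f μ)
    (hexp : Integrable (fun z => Real.exp |f z|) μ) :
    Integrable (fun z => Real.exp |f z - ∫ w, f w ∂μ|) μ := by
  refine (hexp.mul_const (Real.exp |∫ w, f w ∂μ|)).mono'
    (by have := hf.aemeasurable; fun_prop) (ae_of_all _ fun z => ?_)
  rw [Real.norm_eq_abs, Real.abs_exp, ← Real.exp_add, Real.exp_le_exp]
  exact abs_sub _ _

section ExponentialMoment

variable [IsProbabilityMeasure μ]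

lemma integral_exp_abs_sub_integral_le (h0 : ∀ z, 0 ≤ f z) (hf : Integrable f μ)
    (hexp : Integrable (fun z => Real.exp (f z)) μ) :
    ∫ z, Real.exp |f z - ∫ w, f w ∂μ| ∂μ ≤ (∫ z, Real.exp (f z) ∂μ) ^ 2 := by
  have hjensen : Real.exp (∫ z, f z ∂μ) ≤ ∫ z, Real.exp (f z) ∂μ :=
    convexOn_exp.map_integral_le Real.continuous_exp.continuousOn isClosed_univ
      (ae_of_all _ fun _ => Set.mem_univ _) hf hexp
  calc ∫ z, Real.exp |f z - ∫ w, f w ∂μ| ∂μ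
      ≤ ∫ z, Real.exp (f z) * Real.exp (∫ w, f w ∂μ) ∂μ := by
        refine integral_mono_of_nonneg (ae_of_all _ fun z => (Real.exp_pos _).le)
          (hexp.mul_const _) (ae_of_all _ fun z => ?_)
        simp only [← Real.exp_add, Real.exp_le_exp]
        have := integral_nonneg (μ := μ) (f := f) h0
        rw [abs_le]
        constructor <;> linarith [h0 z]
    _ = (∫ z, Real.exp (f z) ∂μ) * Real.exp (∫ z, f z ∂μ) := integral_mul_const _ _
    _ ≤ (∫ z, Real.exp (f z) ∂μ) ^ 2 := by rw [sq]; gcongr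

lemma measureReal_pi_lt_meanDeviation_le_exp (h0 : ∀ z, 0 ≤ f z) (hf : Integrable f μ)
    (hexp : Integrable (fun z => Real.exp (f z)) μ) {C L M : ℝ} (hC : 0 < C) (hL : 0 < L)
    (hV : Var[f; μ] ≤ C ^ 2 / (2 * L)) (hM : ∫ z, Real.exp (f z) ∂μ ≤ M) (hn : 0 < n) :
    (Measure.pi fun _ : Fin n => μ).real
        {S | C / √n + (2 * L + 192 * L ^ 2 * M ^ 2 / C ^ 2) / n < meanDeviation μ f S}
      ≤ 2 * Real.exp (-L) := by
  have hn' : (0 : ℝ) < n := by exact_mod_cast hn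
  set m := ∫ z, f z ∂μ with hm
  set a := C * √n + (2 * L + 192 * L ^ 2 * M ^ 2 / C ^ 2)
  have ha : C / √n + (2 * L + 192 * L ^ 2 * M ^ 2 / C ^ 2) / n = a / n := by
    rw [add_div (C * √n), mul_div_assoc C, Real.sqrt_div_self', mul_one_div]
  have hmean : ∫ z, (f z - m) ∂μ = 0 := by
    rw [integral_sub hf (integrable_const _)]; simp [hm]
  have hsq : ∫ z, (f z - m) ^ 2 ∂μ ≤ C ^ 2 / (2 * L) := by
    rwa [variance_eq_integral hf.aemeasurable] at hV
  have hcexp : Integrable (fun z => Real.exp |f z - m|) μ :=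
    integrable_exp_abs_sub_integral hf (by simpa only [abs_of_nonneg (h0 _)] using hexp)
  have hcexp_le : ∫ z, Real.exp |f z - m| ∂μ ≤ M ^ 2 :=
    (integral_exp_abs_sub_integral_le h0 hf hexp).trans (by
      have : 0 ≤ ∫ z, Real.exp (f z) ∂μ := integral_nonneg fun z => (Real.exp_pos _).le
      gcongr)
  have hmeas : AEMeasurable (fun z => f z - m) μ := hf.aemeasurable.sub_const m
  have hupper := measureReal_pi_bernstein_le hmeas hmean hcexp hC hL hsq hcexp_le n
  have hlower := measureReal_pi_bernstein_le (g := fun z => -(f z - m)) hmeas.neg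
    (by rw [integral_neg, hmean, neg_zero]) (by simpa only [abs_neg] using hcexp) hC hL
    (by simpa only [neg_sq] using hsq) (by simpa only [abs_neg] using hcexp_le) n
  calc _ ≤ (Measure.pi fun _ : Fin n => μ).real
          ({S | a ≤ ∑ i, (f (S i) - m)} ∪ {S | a ≤ ∑ i, -(f (S i) - m)}) := by
        refine measureReal_mono fun S hS => ?_
        rw [Set.mem_ofPred_eq, ha, meanDeviation_eq_abs_sum hn,
          div_lt_div_iff_of_pos_right hn', lt_abs, ← Finset.sum_neg_distrib] at hS
        exact hS.imp le_of_lt le_of_lt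
    _ ≤ Real.exp (-L) + Real.exp (-L) := (measureReal_union_le _ _).trans (add_le_add hupper hlower)
    _ = 2 * Real.exp (-L) := (two_mul _).symm

end ExponentialMoment

section Variance

variable [IsProbabilityMeasure μ]

lemma memLp_sum_pi (hf : MemLp f 2 μ) (n : ℕ) :
    MemLp (fun S : Fin n → Z => ∑ i, f (S i)) 2 (Measure.pi fun _ => μ) :=
  memLp_finsetSum _ fun i _ => hf.comp_measurePreserving (measurePreserving_eval _ i)

lemma integral_sum_pi (hf : Integrable f μ) (n : ℕ) :
    ∫ S : Fin n → Z, ∑ i, f (S i) ∂(Measure.pi fun _ => μ) = n * ∫ z, f z ∂μ := by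
  rw [integral_finsetSum _ fun i _ => integrable_comp_eval (μ := fun _ : Fin n => μ) hf]
  simp [integral_comp_eval (μ := fun _ : Fin n => μ) hf.aestronglyMeasurable]

lemma variance_sum_pi_eq (hf : MemLp f 2 μ) (n : ℕ) :
    Var[fun S : Fin n → Z => ∑ i, f (S i); Measure.pi fun _ => μ] = n * Var[f; μ] := by
  have h := variance_sum_pi (μ := fun _ : Fin n => μ) (X := fun _ => f) fun _ => hf
  rw [Finset.sum_fn] at h
  simp [h]

-- Unlike in Mathlib's Chebyshev inequality the threshold may vanish, hence the strict inequality
-- inside the event.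
lemma measureReal_lt_abs_sub_integral_le {Ω : Type*} [MeasurableSpace Ω] {ν : Measure Ω}
    [IsFiniteMeasure ν] {A : Ω → ℝ} (hA : MemLp A 2 ν) {v ρ : ℝ} (hv : Var[A; ν] ≤ v)
    (hρ : 0 < ρ) : ν.real {ω | √(v / ρ) < |A ω - ∫ ω, A ω ∂ν|} ≤ ρ := by
  rcases ((variance_nonneg A ν).trans hv).eq_or_lt with rfl | hv0
  · have hnull : ν {ω | √(0 / ρ) < |A ω - ∫ ω, A ω ∂ν|} = 0 := by
      rw [measure_eq_zero_iff_ae_notMem]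
      filter_upwards [ae_eq_integral_of_variance_eq_zero hA
        (le_antisymm hv (variance_nonneg _ _))] with ω hω
      simp [hω]
    rw [measureReal_def, hnull]
    exact hρ.le
  · have hpos : 0 < √(v / ρ) := by positivity
    refine ENNReal.toReal_le_of_le_ofReal hρ.le ?_
    calc ν {ω | √(v / ρ) < |A ω - ∫ ω, A ω ∂ν|}
        ≤ ν {ω | √(v / ρ) ≤ |A ω - ∫ ω, A ω ∂ν|} := measure_mono fun ω => le_of_lt (α := ℝ)
      _ ≤ ENNReal.ofReal (Var[A; ν] / √(v / ρ) ^ 2) := meas_ge_le_variance_div_sq hA hpos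
      _ ≤ ENNReal.ofReal ρ := by
        rw [Real.sq_sqrt (by positivity)]
        gcongr
        rw [div_le_iff₀ (by positivity), mul_div_cancel₀ _ hρ.ne']
        exact hv

lemma measureReal_pi_lt_meanDeviation_le (hf : MemLp f 2 μ) {v ρ : ℝ} (hv : Var[f; μ] ≤ v)
    (hρ : 0 < ρ) (hn : 0 < n) :
    (Measure.pi fun _ : Fin n => μ).real {S | √(v / ρ) / √n < meanDeviation μ f S} ≤ ρ := by
  have hn' : (0 : ℝ) < n := by exact_mod_cast hn
  have hvar : Var[fun S : Fin n → Z => ∑ i, f (S i); Measure.pi fun _ => μ] ≤ n * v := by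
    rw [variance_sum_pi_eq hf]
    gcongr
  refine le_trans (measureReal_mono fun S hS => ?_)
    (measureReal_lt_abs_sub_integral_le (memLp_sum_pi hf n) hvar hρ)
  rw [Set.mem_ofPred_eq, meanDeviation_eq_abs_sum hn, lt_div_iff₀ hn', Finset.sum_sub_distrib,
    Finset.sum_const, Finset.card_univ, Fintype.card_fin, nsmul_eq_mul, div_mul_eq_mul_div,
    mul_div_assoc, Real.div_sqrt, mul_comm, ← Real.sqrt_mul n.cast_nonneg, ← mul_div_assoc] at hS
  rwa [Set.mem_ofPred_eq, integral_sum_pi (hf.integrable one_le_two)]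

end Variance

-- All the events lie below one `{ω | b < F ω}` with `b` running through a countable set, and they
-- are nested.
lemma measure_exists_lt_le {Ω ι : Type*} [MeasurableSpace Ω] {ν : Measure Ω} {F : Ω → ℝ}
    {b : ι → ℝ} {ε : ℝ≥0∞} (h : ∀ i, ν {ω | b i < F ω} ≤ ε) : ν {ω | ∃ i, b i < F ω} ≤ ε := by
  obtain ⟨T, hT, hTU⟩ := TopologicalSpace.isOpen_iUnion_countable (fun i => Set.Ioi (b i))
    fun _ => isOpen_Ioi
  have hunion : {ω | ∃ i, b i < F ω} = ⋃ i ∈ T, {ω | b i < F ω} := by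
    ext ω
    simpa using (Set.ext_iff.1 hTU (F ω)).symm
  have hdir : DirectedOn (Function.onFun (· ⊆ ·) fun i => {ω | b i < F ω}) T := fun i hi j hj => by
    rcases le_total (b i) (b j) with hij | hij
    · exact ⟨i, hi, Set.Subset.rfl, fun ω hω => hij.trans_lt hω⟩
    · exact ⟨j, hj, fun ω hω => hij.trans_lt hω, Set.Subset.rfl⟩
  rw [hunion, measure_biUnion_eq_iSup hT hdir]
  exact iSup₂_le fun i _ => h i

lemma one_sub_le_measure_forall_le {Ω ι : Type*} [MeasurableSpace Ω] {ν : Measure Ω}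
    [IsProbabilityMeasure ν] {F : Ω → ℝ} {b : ι → ℝ} {ε : ℝ≥0∞} (h : ∀ i, ν {ω | b i < F ω} ≤ ε) :
    1 - ε ≤ ν {ω | ∀ i, F ω ≤ b i} := by
  have hcompl : {ω | ∀ i, F ω ≤ b i}ᶜ = {ω | ∃ i, b i < F ω} := by
    ext ω
    simp only [Set.mem_compl_iff, Set.mem_ofPred_eq, not_forall, not_le]
  rw [tsub_le_iff_right, ← measure_univ (μ := ν)]
  refine (measure_univ_le_add_compl {ω | ∀ i, F ω ≤ b i}).trans ?_
  rw [hcompl]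
  gcongr
  exact measure_exists_lt_le h

end Concentration

section Constants

variable {m : ℕ} {δ : ℝ}

lemma log_add_four_div_pos (hδ : δ ∈ Set.Ioo (0 : ℝ) 1) : 0 < Real.log (((m : ℝ) + 4) / δ) := by
  refine Real.log_pos ((one_lt_div hδ.1).2 ?_)
  linarith [hδ.2, (Nat.cast_nonneg m : (0 : ℝ) ≤ m)]

lemma lt_constC {v p : ℝ} (hv : 0 < v) (hlog : Real.log m ≤ Real.log (v / p)) :
    √(Real.log (((m : ℝ) + 4) / δ)) * √(m : ℝ) * Real.log m < constC m δ v p := by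
  have hB : √(Real.log (((m : ℝ) + 4) / δ)) ≤ constB m δ := le_add_of_nonneg_left zero_le_one
  have hB0 : 0 ≤ constB m δ := (Real.sqrt_nonneg _).trans hB
  calc √(Real.log (((m : ℝ) + 4) / δ)) * √(m : ℝ) * Real.log m
      ≤ constB m δ * √(m : ℝ) * Real.log (v / p) := by gcongr
    _ < constC m δ v p := lt_add_of_pos_left _ (by positivity)

lemma card_div_two_mul_sq_log_le {L C : ℝ} (hL : 0 < L) (hC : √L * √(m : ℝ) * Real.log m ≤ C) :
    (m : ℝ) / 2 * Real.log m ^ 2 ≤ C ^ 2 / (2 * L) := by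
  rw [le_div_iff₀ (by positivity)]
  calc (m : ℝ) / 2 * Real.log m ^ 2 * (2 * L) = (√L * √(m : ℝ) * Real.log m) ^ 2 := by
        rw [mul_pow, mul_pow, Real.sq_sqrt hL.le, Real.sq_sqrt m.cast_nonneg]; ring
    _ ≤ C ^ 2 := by gcongr

lemma sqrt_div_eq_constD_mul {s h : ℝ} (hs : 0 < s) (hh : 0 ≤ h) :
    √(8 * (√s)⁻¹ * h ^ 2 / (δ / ((m : ℝ) + 4))) = constD m δ s * h := by
  have hpow : (s ^ (-(1 / 4 : ℝ))) ^ 2 = (√s)⁻¹ := by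
    rw [← Real.rpow_natCast, ← Real.rpow_mul hs.le, Real.sqrt_eq_rpow, ← Real.rpow_neg hs.le]
    norm_num
  have hsq : 8 * (√s)⁻¹ * h ^ 2 / (δ / ((m : ℝ) + 4))
      = (s ^ (-(1 / 4 : ℝ)) * h) ^ 2 * (8 * (((m : ℝ) + 4) / δ)) := by
    rw [mul_pow, hpow, div_div_eq_mul_div]; ring
  rw [hsq, Real.sqrt_mul (sq_nonneg _), Real.sqrt_sq (by positivity), constD]
  ring

/-- The coefficient of `1 / n` in the remainder, when the coefficient of `1 / √n` is `C`: the
linear part of a Bernstein bound at confidence level `δ / (m + 4)` for a nonnegative function with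
exponential moment at most `m`. -/
noncomputable def remainderConst (m : ℕ) (δ C : ℝ) : ℝ :=
  2 * Real.log (((m : ℝ) + 4) / δ)
    + 192 * Real.log (((m : ℝ) + 4) / δ) ^ 2 * (m : ℝ) ^ 2 / C ^ 2

lemma remainderConst_nonneg {C : ℝ} (hδ : δ ∈ Set.Ioo (0 : ℝ) 1) : 0 ≤ remainderConst m δ C := by
  have := log_add_four_div_pos (m := m) hδ
  rw [remainderConst]
  positivity

lemma isBigO_const_div_log_div (a : ℝ) :
    (fun n : ℕ => a / n) =O[atTop] fun n : ℕ => Real.log n / n := by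
  have hlog : (fun _ : ℕ => a) =O[atTop] fun n : ℕ => Real.log n :=
    (Real.isLittleO_const_log_atTop.comp_tendsto tendsto_natCast_atTop_atTop).isBigO
  simpa only [div_eq_mul_inv] using hlog.mul (isBigO_refl (fun n : ℕ => (n : ℝ)⁻¹) atTop)

end Constants

section Model

variable {X Y U : Type*} [MeasurableSpace X] [MeasurableSpace U] {vol : Measure U}

section EncoderDecoder

lemma Encoder.measurable_dens_right (q : Encoder X vol) (x : X) : Measurable (q.dens x) :=
  q.measurable_dens.comp measurable_prodMk_left

instance Encoder.isProbabilityMeasure_law (q : Encoder X vol) (x : X) :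
    IsProbabilityMeasure (q.law x) :=
  ⟨by rw [Encoder.law, withDensity_apply _ MeasurableSet.univ, Measure.restrict_univ,
    q.lintegral_dens]⟩

lemma Encoder.lintegral_law (q : Encoder X vol) (x : X) {g : U → ℝ≥0∞} (hg : Measurable g) :
    ∫⁻ u, g u ∂(q.law x) = ∫⁻ u, q.dens x u * g u ∂vol :=
  lintegral_withDensity_eq_lintegral_mul _ (q.measurable_dens_right x).coe_nnreal_ennreal hg

variable [Fintype Y]

lemma Decoder.prob_le_one (Q : Decoder U Y) (u : U) (y : Y) : Q.prob u y ≤ 1 :=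
  Q.sum_prob u ▸ Finset.single_le_sum (fun y _ => Q.prob_nonneg u y) (Finset.mem_univ y)

lemma Decoder.minProb_le (Q : Decoder U Y) (u : U) (y : Y) : Q.minProb ≤ Q.prob u y :=
  ciInf_le (f := fun z : U × Y => Q.prob z.1 z.2)
    ⟨0, by rintro _ ⟨z, rfl⟩; exact Q.prob_nonneg z.1 z.2⟩ (u, y)

lemma Decoder.abs_neg_log_prob_le {Q : Decoder U Y} (hQ : 0 < Q.minProb) (u : U) (y : Y) :
    |(-Real.log (Q.prob u y))| ≤ -Real.log Q.minProb := by
  rw [abs_of_nonneg (neg_nonneg.2 (Real.log_nonpos (Q.prob_nonneg u y) (Q.prob_le_one u y)))]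
  exact neg_le_neg (Real.log_le_log hQ (Q.minProb_le u y))

lemma Decoder.measurable_neg_log_prob (Q : Decoder U Y) (y : Y) :
    Measurable fun u => -Real.log (Q.prob u y) :=
  (Q.measurable_prob y).log.neg

lemma Decoder.integrable_neg_log_prob {Q : Decoder U Y} (hQ : 0 < Q.minProb) (ρ : Measure U)
    [IsFiniteMeasure ρ] (y : Y) : Integrable (fun u => -Real.log (Q.prob u y)) ρ :=
  .of_bound (Q.measurable_neg_log_prob y).aestronglyMeasurable _
    (ae_of_all _ fun u => Decoder.abs_neg_log_prob_le hQ u y)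

lemma abs_loss_le (q : Encoder X vol) {Q : Decoder U Y} (hQ : 0 < Q.minProb) (x : X) (y : Y) :
    |loss q Q x y| ≤ -Real.log Q.minProb := by
  simpa [loss] using norm_integral_le_of_norm_le_const (μ := q.law x)
    (f := fun u => -Real.log (Q.prob u y))
    (ae_of_all _ fun u => Decoder.abs_neg_log_prob_le hQ u y)

lemma measurable_loss [MeasurableSpace Y] [MeasurableSingletonClass Y] [SFinite vol]
    (q : Encoder X vol) (Q : Decoder U Y) : Measurable fun z : X × Y => loss q Q z.1 z.2 := by
  refine measurable_from_prod_countable_left fun y => ?_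
  have hloss : ∀ x, loss q Q x y = ∫ u, (q.dens x u : ℝ) * -Real.log (Q.prob u y) ∂vol :=
    fun x => integral_withDensity_eq_integral_smul (q.measurable_dens_right x) _
  simp only [hloss]
  have hmeas : Measurable (Function.uncurry fun (x : X) (u : U) =>
      (q.dens x u : ℝ) * -Real.log (Q.prob u y)) :=
    q.measurable_dens.coe_nnreal_real.mul ((Q.measurable_neg_log_prob y).comp measurable_snd)
  exact hmeas.stronglyMeasurable.integral_prod_right.measurable

end EncoderDecoder

section Quantizer

variable {K : ℕ} (c : Quantization X Y K)

lemma Quantization.exists_mem_cell (z : X × Y) : ∃ k, z.1 ∈ c.cell k z.2 :=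
  Set.mem_iUnion.1 (by rw [c.iUnion_cell]; trivial)

/-- The quantizer, mapping a labelled input to the index of its cell and its label. -/
noncomputable def Quantization.quantize (z : X × Y) : Fin K × Y :=
  ((c.exists_mem_cell z).choose, z.2)

/-- The centroid `x^{(k, y)}` of the cell of a labelled input; replacing every input by its
centroid turns `p_{XY}` into the quantized distribution. -/
noncomputable def Quantization.centroid (z : X × Y) : X :=
  c.center (c.quantize z).1 z.2

lemma Quantization.mem_cell_quantize (z : X × Y) : z.1 ∈ c.cell (c.quantize z).1 z.2 :=
  (c.exists_mem_cell z).choose_spec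

lemma Quantization.preimage_quantize (k : Fin K) (y : Y) :
    c.quantize ⁻¹' {(k, y)} = c.cell k y ×ˢ {y} := by
  ext ⟨x, y'⟩
  refine ⟨fun h => ?_, ?_⟩
  · obtain rfl : y' = y := congrArg Prod.snd h
    have hk : (c.quantize (x, y')).1 = k := congrArg Prod.fst h
    exact ⟨hk ▸ c.mem_cell_quantize (x, y'), rfl⟩
  · rintro ⟨hx, rfl⟩
    refine Prod.ext ?_ rfl
    by_contra hne
    exact Set.disjoint_left.1 (c.disjoint_cell y' hne) (c.mem_cell_quantize (x, y')) hx

lemma abs_loss_sub_loss_centroid_le [Fintype Y] (q : Encoder X vol) {Q : Decoder U Y}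
    (hQ : 0 < Q.minProb) (z : X × Y) :
    |loss q Q z.1 z.2 - loss q Q (c.centroid z) z.2| ≤ epsilonK q Q c := by
  refine le_csSup ⟨2 * -Real.log Q.minProb, ?_⟩
    ⟨(c.quantize z).1, z.2, z.1, c.mem_cell_quantize z, rfl⟩
  rintro _ ⟨k, y, x, -, rfl⟩
  refine (abs_sub _ _).trans ?_
  linarith [abs_loss_le q hQ x y, abs_loss_le q hQ (c.center k y) y]

variable [MeasurableSpace Y] [MeasurableSingletonClass Y]

lemma Quantization.measurable_quantize [Countable Y] : Measurable c.quantize := by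
  refine measurable_to_countable' fun ⟨k, y⟩ => ?_
  rw [c.preimage_quantize]
  exact (c.measurableSet_cell k y).prod (measurableSet_singleton y)

lemma Quantization.measurable_comp_quantize [Countable Y] {β : Type*} [MeasurableSpace β]
    (F : Fin K × Y → β) : Measurable fun z => F (c.quantize z) :=
  Measurable.of_discrete.comp c.measurable_quantize

lemma Quantization.memLp_comp_quantize [Finite Y] (P : Measure (X × Y)) [IsFiniteMeasure P]
    (F : Fin K × Y → ℝ) (p : ℝ≥0∞) : MemLp (fun z => F (c.quantize z)) p P := by
  have hfin : (Set.range fun a => ‖F a‖).Finite := Set.finite_range _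
  obtain ⟨b, hb⟩ := hfin.bddAbove
  exact .of_bound (c.measurable_comp_quantize F).aestronglyMeasurable b
    (ae_of_all _ fun z => hb ⟨c.quantize z, rfl⟩)

end Quantizer

section QuantizedLaw

variable [MeasurableSpace Y] {K : ℕ} (P : Measure (X × Y)) (q : Encoder X vol)
  (c : Quantization X Y K)

lemma jointD_nonneg (u : U) (y : Y) : 0 ≤ jointD P q c u y :=
  Finset.sum_nonneg fun _ _ => by positivity

lemma measurable_jointD (y : Y) : Measurable fun u => jointD P q c u y :=
  Finset.measurable_fun_sum _ fun _ _ =>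
    (q.measurable_dens_right _).coe_nnreal_real.mul_const _

/-- The conditional expectation of `φ U Y` given the cell and the label of `z`, under the quantized
distribution, in which the representation is drawn from the centroid of the cell. -/
noncomputable def cellMean (φ : U → Y → ℝ) (z : X × Y) : ℝ :=
  ∫ u, φ u z.2 ∂(q.law (c.centroid z))

lemma memLp_comp_cellMean [Finite Y] [MeasurableSingletonClass Y] [IsFiniteMeasure P]
    (φ : U → Y → ℝ) (g : ℝ → ℝ) (p : ℝ≥0∞) : MemLp (fun z => g (cellMean q c φ z)) p P :=
  c.memLp_comp_quantize P (fun a => g (∫ u, φ u a.2 ∂(q.law (c.center a.1 a.2)))) p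

variable [Fintype Y]

lemma densD_nonneg (u : U) : 0 ≤ densD P q c u :=
  Finset.sum_nonneg fun _ _ => jointD_nonneg P q c u _

lemma measurable_densD : Measurable (densD P q c) :=
  Finset.measurable_fun_sum _ fun _ _ => measurable_jointD P q c _

lemma jointD_le_densD (u : U) (y : Y) : jointD P q c u y ≤ densD P q c u :=
  Finset.single_le_sum (fun y _ => jointD_nonneg P q c u y) (Finset.mem_univ y)

lemma decoderD_nonneg (u : U) (y : Y) : 0 ≤ decoderD P q c u y :=
  div_nonneg (jointD_nonneg P q c u y) (densD_nonneg P q c u)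

lemma decoderD_le_one (u : U) (y : Y) : decoderD P q c u y ≤ 1 :=
  div_le_one_of_le₀ (jointD_le_densD P q c u y) (densD_nonneg P q c u)

lemma measurable_decoderD (y : Y) : Measurable fun u => decoderD P q c u y :=
  (measurable_jointD P q c y).div (measurable_densD P q c)

lemma densD_mul_decoderD (u : U) (y : Y) : densD P q c u * decoderD P q c u y = jointD P q c u y :=
  mul_div_cancel_of_imp' fun hu =>
    le_antisymm (hu ▸ jointD_le_densD P q c u y) (jointD_nonneg P q c u y)

/-- The law of the representation under the quantized distribution, with density `q_U^D`. -/
noncomputable def quantizedMarginal : Measure U :=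
  vol.withDensity fun u => ENNReal.ofReal (densD P q c u)

lemma ae_sum_decoderD_eq_one :
    ∀ᵐ u ∂(quantizedMarginal P q c), ∑ y, decoderD P q c u y = 1 := by
  rw [quantizedMarginal, ae_withDensity_iff (measurable_densD P q c).ennreal_ofReal]
  refine ae_of_all _ fun u hu => ?_
  simp only [decoderD, ← Finset.sum_div]
  exact div_self fun h => hu (by rw [densD, h, ENNReal.ofReal_zero])

section Tower

variable [MeasurableSingletonClass Y]

lemma lintegral_comp_quantize {F : Fin K × Y → ℝ≥0∞} :
    ∫⁻ z, F (c.quantize z) ∂P = ∑ y, ∑ k, F (k, y) * P (c.cell k y ×ˢ {y}) := by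
  rw [← lintegral_map Measurable.of_discrete c.measurable_quantize, lintegral_fintype,
    Fintype.sum_prod_type_right]
  simp only [Measure.map_apply c.measurable_quantize (measurableSet_singleton _),
    c.preimage_quantize]

lemma lintegral_lintegral_law_centroid [IsFiniteMeasure P] {φ : U → Y → ℝ≥0∞}
    (hφ : ∀ y, Measurable fun u => φ u y) :
    ∫⁻ z, ∫⁻ u, φ u z.2 ∂(q.law (c.centroid z)) ∂P
      = ∫⁻ u, ∑ y, ENNReal.ofReal (decoderD P q c u y) * φ u y ∂(quantizedMarginal P q c) := by
  have hdens : ∀ x, Measurable fun u => (q.dens x u : ℝ≥0∞) := fun x =>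
    (q.measurable_dens_right x).coe_nnreal_ennreal
  have hjoint : ∀ u y, ENNReal.ofReal (jointD P q c u y)
      = ∑ k, q.dens (c.center k y) u * P (c.cell k y ×ˢ {y}) := fun u y => by
    rw [jointD, ENNReal.ofReal_sum_of_nonneg fun _ _ => by positivity]
    refine Finset.sum_congr rfl fun k _ => ?_
    rw [ENNReal.ofReal_mul (by positivity), ENNReal.ofReal_coe_nnreal, ofReal_measureReal]
  calc ∫⁻ z, ∫⁻ u, φ u z.2 ∂(q.law (c.centroid z)) ∂P
      = ∑ y, ∑ k, (∫⁻ u, φ u y ∂(q.law (c.center k y))) * P (c.cell k y ×ˢ {y}) :=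
        lintegral_comp_quantize P c (F := fun a => ∫⁻ u, φ u a.2 ∂(q.law (c.center a.1 a.2)))
    _ = ∑ y, ∫⁻ u, ENNReal.ofReal (jointD P q c u y) * φ u y ∂vol := by
        refine Finset.sum_congr rfl fun y _ => ?_
        simp only [hjoint, Finset.sum_mul]
        rw [lintegral_finsetSum Finset.univ fun k _ => by fun_prop]
        refine Finset.sum_congr rfl fun k _ => ?_
        have hprod : Measurable fun u => (q.dens (c.center k y) u : ℝ≥0∞) * φ u y :=
          (hdens _).mul (hφ y)
        rw [q.lintegral_law _ (hφ y), ← lintegral_mul_const _ hprod]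
        simp only [mul_right_comm]
    _ = ∫⁻ u, ∑ y, ENNReal.ofReal (jointD P q c u y) * φ u y ∂vol :=
        (lintegral_finsetSum _ fun y _ =>
          (measurable_jointD P q c y).ennreal_ofReal.mul (hφ y)).symm
    _ = _ := by
        have hdec : Measurable fun u =>
            ∑ y, ENNReal.ofReal (decoderD P q c u y) * φ u y :=
          Finset.measurable_fun_sum _ fun y _ =>
            (measurable_decoderD P q c y).ennreal_ofReal.mul (hφ y)
        rw [quantizedMarginal, lintegral_withDensity_eq_lintegral_mul _
          (measurable_densD P q c).ennreal_ofReal hdec]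
        simp only [Pi.mul_apply, Finset.mul_sum, ← mul_assoc,
          ← ENNReal.ofReal_mul (densD_nonneg P q c _), densD_mul_decoderD]

instance isProbabilityMeasure_quantizedMarginal [IsProbabilityMeasure P] :
    IsProbabilityMeasure (quantizedMarginal P q c) := by
  have htower := lintegral_lintegral_law_centroid P q c (φ := fun _ _ => 1)
    fun _ => measurable_const
  have hone : ∀ᵐ u ∂(quantizedMarginal P q c),
      ∑ y, ENNReal.ofReal (decoderD P q c u y) * 1 = 1 := by
    filter_upwards [ae_sum_decoderD_eq_one P q c] with u hu
    simp only [mul_one]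
    rw [← ENNReal.ofReal_sum_of_nonneg fun y _ => decoderD_nonneg P q c u y, hu,
      ENNReal.ofReal_one]
  rw [lintegral_congr_ae hone] at htower
  exact ⟨by simpa using htower.symm⟩

lemma ofReal_map_integral_le {Ω : Type*} [MeasurableSpace Ω] {ρ : Measure Ω}
    [IsProbabilityMeasure ρ] {g : ℝ → ℝ} (hg : ConvexOn ℝ Set.univ g) (hgc : Continuous g)
    (hg0 : ∀ x, 0 ≤ g x) {f : Ω → ℝ} (hf : Integrable f ρ) :
    ENNReal.ofReal (g (∫ ω, f ω ∂ρ)) ≤ ∫⁻ ω, ENNReal.ofReal (g (f ω)) ∂ρ := by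
  by_cases htop : ∫⁻ ω, ENNReal.ofReal (g (f ω)) ∂ρ = ∞
  · exact htop ▸ le_top
  have hint : Integrable (fun ω => g (f ω)) ρ :=
    (lintegral_ofReal_ne_top_iff_integrable (hgc.comp_aestronglyMeasurable hf.aestronglyMeasurable)
      (ae_of_all _ fun ω => hg0 _)).1 htop
  rw [← ofReal_integral_eq_lintegral_ofReal hint (ae_of_all _ fun ω => hg0 _)]
  exact ENNReal.ofReal_le_ofReal (hg.map_integral_le hgc.continuousOn isClosed_univ
    (ae_of_all _ fun _ => Set.mem_univ _) hf hint)

lemma integral_comp_cellMean_le [IsFiniteMeasure P] {g : ℝ → ℝ} (hg : ConvexOn ℝ Set.univ g)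
    (hgc : Continuous g) (hg0 : ∀ x, 0 ≤ g x) {φ : U → Y → ℝ}
    (hφ : ∀ y, Measurable fun u => φ u y)
    (hint : ∀ᵐ z ∂P, Integrable (fun u => φ u z.2) (q.law (c.centroid z))) {B : U → ℝ}
    (hB : Integrable B (quantizedMarginal P q c))
    (hle : ∀ᵐ u ∂(quantizedMarginal P q c), ∑ y, decoderD P q c u y * g (φ u y) ≤ B u) :
    ∫ z, g (cellMean q c φ z) ∂P ≤ ∫ u, B u ∂(quantizedMarginal P q c) := by
  have hsum : ∀ u, 0 ≤ ∑ y, decoderD P q c u y * g (φ u y) := fun u =>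
    Finset.sum_nonneg fun y _ => mul_nonneg (decoderD_nonneg P q c u y) (hg0 _)
  have hB0 : 0 ≤ᵐ[quantizedMarginal P q c] B := hle.mono fun u hu => (hsum u).trans hu
  rw [← ENNReal.ofReal_le_ofReal_iff (integral_nonneg_of_ae hB0)]
  calc ENNReal.ofReal (∫ z, g (cellMean q c φ z) ∂P)
      = ∫⁻ z, ENNReal.ofReal (g (cellMean q c φ z)) ∂P :=
        ofReal_integral_eq_lintegral_ofReal
          ((memLp_comp_cellMean P q c φ g 1).integrable le_rfl) (ae_of_all _ fun z => hg0 _)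
    _ ≤ ∫⁻ z, ∫⁻ u, ENNReal.ofReal (g (φ u z.2)) ∂(q.law (c.centroid z)) ∂P :=
        lintegral_mono_ae (hint.mono fun z hz => ofReal_map_integral_le hg hgc hg0 hz)
    _ = ∫⁻ u, ∑ y, ENNReal.ofReal (decoderD P q c u y) * ENNReal.ofReal (g (φ u y))
          ∂(quantizedMarginal P q c) :=
        lintegral_lintegral_law_centroid P q c (φ := fun u y => ENNReal.ofReal (g (φ u y)))
          fun y => (hgc.measurable.comp (hφ y)).ennreal_ofReal
    _ ≤ ∫⁻ u, ENNReal.ofReal (B u) ∂(quantizedMarginal P q c) := by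
        refine lintegral_mono_ae (hle.mono fun u hu => ?_)
        simp only [← ENNReal.ofReal_mul (decoderD_nonneg P q c u _)]
        rw [← ENNReal.ofReal_sum_of_nonneg fun y _ =>
          mul_nonneg (decoderD_nonneg P q c u y) (hg0 _)]
        exact ENNReal.ofReal_le_ofReal hu
    _ = ENNReal.ofReal (∫ u, B u ∂(quantizedMarginal P q c)) :=
        (ofReal_integral_eq_lintegral_ofReal hB hB0).symm

end Tower

section InformationOfLabel

lemma measurable_neg_log_decoderD (y : Y) : Measurable fun u => -Real.log (decoderD P q c u y) :=
  (measurable_decoderD P q c y).log.neg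

lemma sum_decoderD_mul_exp_le (u : U) :
    ∑ y, decoderD P q c u y * Real.exp (-Real.log (decoderD P q c u y)) ≤ Fintype.card Y := by
  refine (Finset.sum_le_sum fun y _ => mul_exp_neg_log_le (decoderD_nonneg P q c u y)).trans ?_
  simp

/-- The conditional expectation `E[-log Q^D(Y|U)]` of the information content of the label given
the cell and the label, under the quantized distribution. -/
noncomputable def cellInfo : X × Y → ℝ :=
  cellMean q c fun u y => -Real.log (decoderD P q c u y)

lemma cellInfo_nonneg (z : X × Y) : 0 ≤ cellInfo P q c z :=
  integral_nonneg fun u =>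
    neg_nonneg.2 (Real.log_nonpos (decoderD_nonneg P q c u z.2) (decoderD_le_one P q c u z.2))

variable [MeasurableSingletonClass Y] [IsProbabilityMeasure P]

lemma memLp_cellInfo (p : ℝ≥0∞) : MemLp (cellInfo P q c) p P :=
  memLp_comp_cellMean P q c _ id p

lemma ae_integrable_neg_log_decoderD :
    ∀ᵐ z ∂P, Integrable (fun u => -Real.log (decoderD P q c u z.2)) (q.law (c.centroid z)) := by
  have hm := measurable_neg_log_decoderD P q c
  have hfin : ∫⁻ z, ∫⁻ u, ENNReal.ofReal (-Real.log (decoderD P q c u z.2))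
      ∂(q.law (c.centroid z)) ∂P ≠ ∞ := by
    rw [lintegral_lintegral_law_centroid P q c
      (φ := fun u y => ENNReal.ofReal (-Real.log (decoderD P q c u y))) fun y =>
        (hm y).ennreal_ofReal]
    refine ne_top_of_le_ne_top (ENNReal.natCast_ne_top (Fintype.card Y))
      ((lintegral_mono (g := fun _ => (Fintype.card Y : ℝ≥0∞)) fun u => ?_).trans (by simp))
    refine (Finset.sum_le_sum (g := fun _ => (1 : ℝ≥0∞)) fun y _ => ?_).trans (by simp)
    rw [← ENNReal.ofReal_mul (decoderD_nonneg P q c u y), mul_neg, ← neg_mul,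
      ENNReal.ofReal_le_one]
    exact (Real.negMulLog_le_one_sub_self (decoderD_nonneg P q c u y)).trans
      (sub_le_self _ (decoderD_nonneg P q c u y))
  have hmeas : Measurable fun z : X × Y =>
      ∫⁻ u, ENNReal.ofReal (-Real.log (decoderD P q c u z.2)) ∂(q.law (c.centroid z)) :=
    c.measurable_comp_quantize fun a =>
      ∫⁻ u, ENNReal.ofReal (-Real.log (decoderD P q c u a.2)) ∂(q.law (c.center a.1 a.2))
  filter_upwards [ae_lt_top hmeas hfin] with z hz
  exact (lintegral_ofReal_ne_top_iff_integrable (hm z.2).aestronglyMeasurable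
    (ae_of_all _ fun u => neg_nonneg.2 (Real.log_nonpos (decoderD_nonneg P q c u z.2)
      (decoderD_le_one P q c u z.2)))).1 hz.ne

lemma integral_exp_cellInfo_le : ∫ z, Real.exp (cellInfo P q c z) ∂P ≤ Fintype.card Y := by
  refine (integral_comp_cellMean_le P q c convexOn_exp Real.continuous_exp
    (fun x => (Real.exp_pos x).le) (measurable_neg_log_decoderD P q c)
    (ae_integrable_neg_log_decoderD P q c) (integrable_const (Fintype.card Y : ℝ))
    (ae_of_all _ (sum_decoderD_mul_exp_le P q c))).trans ?_
  simp

lemma variance_cellInfo_le : ProbabilityTheory.variance (cellInfo P q c) P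
    ≤ (Fintype.card Y : ℝ) / 2 * Real.log (Fintype.card Y) ^ 2 := by
  obtain ⟨a, ha⟩ := exists_sum_mul_sq_neg_log_sub_le Y
  have hconv : ConvexOn ℝ Set.univ fun x : ℝ => (x - a) ^ 2 := by
    have := (even_two.convexOn_pow (𝕜 := ℝ)).translate_right (-a)
    simpa only [Function.comp_def, neg_add_eq_sub, Set.preimage_univ] using this
  have hm : AEStronglyMeasurable (cellInfo P q c) P :=
    (memLp_cellInfo P q c 2).aestronglyMeasurable
  have hmoment : ∫ z, (cellInfo P q c z - a) ^ 2 ∂P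
      ≤ ∫ _u, (Fintype.card Y : ℝ) / 2 * Real.log (Fintype.card Y) ^ 2
          ∂(quantizedMarginal P q c) :=
    integral_comp_cellMean_le P q c hconv (by fun_prop) (fun _ => sq_nonneg _)
      (measurable_neg_log_decoderD P q c) (ae_integrable_neg_log_decoderD P q c)
      (integrable_const _)
      ((ae_sum_decoderD_eq_one P q c).mono fun u hu => ha _ (decoderD_nonneg P q c u) hu)
  rw [integral_const, probReal_univ, one_smul] at hmoment
  rw [← ProbabilityTheory.variance_sub_const hm a]
  exact (ProbabilityTheory.variance_le_expectation_sq
    (hm.sub aestronglyMeasurable_const)).trans hmoment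

end InformationOfLabel

section ExcessLoss

variable (Q : Decoder U Y)

/-- The loss at the centroid in excess of the information content of the label. -/
noncomputable def cellExcess (z : X × Y) : ℝ :=
  loss q Q (c.centroid z) z.2 - cellInfo P q c z

lemma integrable_sum_sq_sqrt_sub_sqrt [MeasurableSingletonClass Y] [IsProbabilityMeasure P] :
    Integrable (fun u => ∑ y, (√(Q.prob u y) - √(decoderD P q c u y)) ^ 2)
      (quantizedMarginal P q c) := by
  refine integrable_finsetSum _ fun y _ => .of_bound (((Q.measurable_prob y).sqrt.sub
    (measurable_decoderD P q c y).sqrt).pow_const 2).aestronglyMeasurable 1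
      (ae_of_all _ fun u => ?_)
  rw [Real.norm_of_nonneg (sq_nonneg _), sq_le_one_iff_abs_le_one]
  exact abs_sub_le_of_nonneg_of_le
    (Real.sqrt_nonneg _) (Real.sqrt_le_one.2 (Q.prob_le_one u y))
    (Real.sqrt_nonneg _) (Real.sqrt_le_one.2 (decoderD_le_one P q c u y))

lemma integral_sum_sq_sqrt_sub_sqrt :
    ∫ u, ∑ y, (√(Q.prob u y) - √(decoderD P q c u y)) ^ 2 ∂(quantizedMarginal P q c)
      = 2 * hellinger P q Q c ^ 2 := by
  have h0 : 0 ≤ ∫ u, ∑ y, (√(Q.prob u y) - √(decoderD P q c u y)) ^ 2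
      ∂(quantizedMarginal P q c) :=
    integral_nonneg fun u => Finset.sum_nonneg fun y _ => sq_nonneg _
  rw [hellinger, ← quantizedMarginal, Real.sq_sqrt (mul_nonneg one_half_pos.le h0)]
  ring

variable {Q} [MeasurableSingletonClass Y] [IsProbabilityMeasure P]

lemma memLp_cellExcess (p : ℝ≥0∞) : MemLp (cellExcess P q c Q) p P :=
  (memLp_comp_cellMean P q c (fun u y => -Real.log (Q.prob u y)) id p).sub (memLp_cellInfo P q c p)

lemma cellExcess_ae_eq (hQ : 0 < Q.minProb) :
    cellExcess P q c Q =ᵐ[P]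
      cellMean q c fun u y => Real.log (decoderD P q c u y) - Real.log (Q.prob u y) := by
  filter_upwards [ae_integrable_neg_log_decoderD P q c] with z hz
  rw [cellExcess, cellInfo, cellMean, cellMean, loss,
    ← integral_sub (Decoder.integrable_neg_log_prob hQ _ z.2) hz]
  exact integral_congr_ae (ae_of_all _ fun u => neg_sub_neg _ _)

lemma integral_cellExcess_sq_le (hQ : 0 < Q.minProb) :
    ∫ z, cellExcess P q c Q z ^ 2 ∂P ≤ 8 * (√Q.minProb)⁻¹ * hellinger P q Q c ^ 2 := by
  have hint : ∀ᵐ z ∂P, Integrable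
      (fun u => Real.log (decoderD P q c u z.2) - Real.log (Q.prob u z.2))
      (q.law (c.centroid z)) := by
    filter_upwards [ae_integrable_neg_log_decoderD P q c] with z hz
    simpa only [Pi.sub_def, neg_sub_neg] using (Decoder.integrable_neg_log_prob hQ _ z.2).sub hz
  calc ∫ z, cellExcess P q c Q z ^ 2 ∂P
      = ∫ z, cellMean q c (fun u y => Real.log (decoderD P q c u y) - Real.log (Q.prob u y)) z ^ 2
          ∂P := integral_congr_ae ((cellExcess_ae_eq P q c hQ).fun_comp (· ^ 2))
    _ ≤ ∫ u, 4 * (√Q.minProb)⁻¹ * ∑ y, (√(Q.prob u y) - √(decoderD P q c u y)) ^ 2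
          ∂(quantizedMarginal P q c) := by
        refine integral_comp_cellMean_le P q c (even_two.convexOn_pow (𝕜 := ℝ)) (by fun_prop)
          (fun _ => sq_nonneg _)
          (fun y => (measurable_decoderD P q c y).log.sub (Q.measurable_prob y).log) hint
          ((integrable_sum_sq_sqrt_sub_sqrt P q c Q).const_mul _) (ae_of_all _ fun u => ?_)
        rw [Finset.mul_sum]
        exact Finset.sum_le_sum fun y _ => mul_sq_log_sub_log_le (decoderD_nonneg P q c u y)
          (decoderD_le_one P q c u y) hQ (Q.minProb_le u y)
    _ = 8 * (√Q.minProb)⁻¹ * hellinger P q Q c ^ 2 := by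
        rw [integral_const_mul, integral_sum_sq_sqrt_sub_sqrt]; ring

end ExcessLoss

section ErrorGap

variable {Q : Decoder U Y} [MeasurableSingletonClass Y] [IsProbabilityMeasure P]

lemma gap_le_add_meanDeviation [SFinite vol] (hQ : 0 < Q.minProb) {n : ℕ} (hn : 0 < n)
    (S : Fin n → X × Y) :
    gap P q Q S ≤ 2 * epsilonK q Q c
      + (meanDeviation P (cellInfo P q c) S + meanDeviation P (cellExcess P q c Q) S) := by
  have hloss : Integrable (fun z : X × Y => loss q Q z.1 z.2) P :=
    .of_bound (measurable_loss q Q).aestronglyMeasurable _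
      (ae_of_all _ fun z => abs_loss_le q hQ z.1 z.2)
  have hinfo : Integrable (cellInfo P q c) P := (memLp_cellInfo P q c 1).integrable le_rfl
  have hexcess : Integrable (cellExcess P q c Q) P := (memLp_cellExcess P q c 1).integrable le_rfl
  have hcentroid : Integrable (fun z => loss q Q (c.centroid z) z.2) P :=
    (hexcess.add hinfo).congr (ae_of_all _ fun z => sub_add_cancel _ _)
  set d : X × Y → ℝ := fun z => loss q Q z.1 z.2 - loss q Q (c.centroid z) z.2
  have hsplit : (fun z : X × Y => loss q Q z.1 z.2)
      = d + (cellInfo P q c + cellExcess P q c Q) := by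
    funext z
    simp only [d, cellExcess, Pi.add_apply]
    ring
  calc gap P q Q S = meanDeviation P (d + (cellInfo P q c + cellExcess P q c Q)) S :=
        congrArg (meanDeviation P · S) hsplit
    _ ≤ meanDeviation P d S + meanDeviation P (cellInfo P q c + cellExcess P q c Q) S :=
        meanDeviation_add_le (hloss.sub hcentroid) (hinfo.add hexcess) S
    _ ≤ 2 * epsilonK q Q c
          + (meanDeviation P (cellInfo P q c) S + meanDeviation P (cellExcess P q c Q) S) :=
        add_le_add (meanDeviation_le_of_abs_le (abs_loss_sub_loss_centroid_le c q hQ) hn S)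
          (meanDeviation_add_le hinfo hexcess S)

variable {δ : ℝ} {n : ℕ}

lemma measureReal_pi_lt_meanDeviation_cellInfo_le (hδ : δ ∈ Set.Ioo (0 : ℝ) 1) {C : ℝ}
    (hC0 : 0 < C) (hC : √(Real.log (((Fintype.card Y : ℝ) + 4) / δ)) * √(Fintype.card Y : ℝ)
      * Real.log (Fintype.card Y) ≤ C) (hn : 0 < n) :
    (Measure.pi fun _ : Fin n => P).real
        {S | C / √n + remainderConst (Fintype.card Y) δ C / n < meanDeviation P (cellInfo P q c) S}
      ≤ 2 * (δ / (Fintype.card Y + 4)) := by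
  have hL := log_add_four_div_pos (m := Fintype.card Y) hδ
  have hexp : Real.exp (-Real.log (((Fintype.card Y : ℝ) + 4) / δ)) = δ / (Fintype.card Y + 4) := by
    have := hδ.1
    rw [Real.exp_neg, Real.exp_log (by positivity), inv_div]
  rw [← hexp]
  exact measureReal_pi_lt_meanDeviation_le_exp (cellInfo_nonneg P q c)
    ((memLp_cellInfo P q c 1).integrable le_rfl)
    ((memLp_comp_cellMean P q c _ Real.exp 1).integrable le_rfl) hC0 hL
    ((variance_cellInfo_le P q c).trans (card_div_two_mul_sq_log_le hL hC))
    (integral_exp_cellInfo_le P q c) hn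

lemma measureReal_pi_lt_meanDeviation_cellExcess_le (hδ : 0 < δ) (hQ : 0 < Q.minProb)
    (hn : 0 < n) :
    (Measure.pi fun _ : Fin n => P).real
        {S | constD (Fintype.card Y) δ Q.minProb * hellinger P q Q c / √n
          < meanDeviation P (cellExcess P q c Q) S} ≤ δ / (Fintype.card Y + 4) := by
  have hL2 : MemLp (cellExcess P q c Q) 2 P := memLp_cellExcess P q c 2
  have hH : 0 ≤ hellinger P q Q c := Real.sqrt_nonneg _
  rw [← sqrt_div_eq_constD_mul hQ hH]
  exact measureReal_pi_lt_meanDeviation_le hL2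
    ((ProbabilityTheory.variance_le_expectation_sq hL2.aestronglyMeasurable).trans
      (integral_cellExcess_sq_le P q c hQ)) (by positivity) hn

lemma measure_pi_lt_gap_le [SFinite vol] (hδ : δ ∈ Set.Ioo (0 : ℝ) 1) {C : ℝ}
    (hC0 : 0 < C) (hC : √(Real.log (((Fintype.card Y : ℝ) + 4) / δ)) * √(Fintype.card Y : ℝ)
      * Real.log (Fintype.card Y) ≤ C) (hQ : 0 < Q.minProb) (hn : 0 < n) :
    (Measure.pi fun _ : Fin n => P)
        {S | 2 * epsilonK q Q c + (constD (Fintype.card Y) δ Q.minProb * hellinger P q Q c + C) / √n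
          + remainderConst (Fintype.card Y) δ C / n < gap P q Q S} ≤ ENNReal.ofReal δ := by
  have hinfo := measureReal_pi_lt_meanDeviation_cellInfo_le P q c hδ hC0 hC hn
  have hexcess := measureReal_pi_lt_meanDeviation_cellExcess_le P q c hδ.1 hQ hn
  have hδ3 : 3 * (δ / (Fintype.card Y + 4)) ≤ δ := by
    rw [mul_div_left_comm]
    refine mul_le_of_le_one_right hδ.1.le ((div_le_one (by positivity)).2 ?_)
    linarith [(Nat.cast_nonneg (Fintype.card Y) : (0 : ℝ) ≤ _)]
  rw [← ofReal_measureReal]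
  refine ENNReal.ofReal_le_ofReal (le_trans ?_ hδ3)
  refine (measureReal_mono (fun S hS => ?_)).trans
    ((measureReal_union_le _ _).trans ((add_le_add hinfo hexcess).trans_eq (by ring)))
  by_contra hnot
  simp only [Set.mem_union, Set.mem_ofPred_eq, not_or, not_lt] at hnot hS
  have hgap := gap_le_add_meanDeviation P q c hQ hn S
  rw [add_div] at hS
  linarith [hnot.1, hnot.2]

lemma log_card_le_log_div_minClassProb (hP : 0 < minClassProb P) {v : ℝ} (hv : 1 ≤ v) :
    Real.log (Fintype.card Y) ≤ Real.log (v / minClassProb P) := by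
  have : Nonempty Y := ⟨P.nonempty_of_neZero.some.2⟩
  have := Measure.isProbabilityMeasure_map (μ := P) (f := Prod.snd) measurable_snd.aemeasurable
  refine Real.log_le_log (by exact_mod_cast Fintype.card_pos) ((le_div_iff₀ hP).2 ?_)
  calc (Fintype.card Y : ℝ) * minClassProb P = ∑ _y : Y, minClassProb P := by simp
    _ ≤ ∑ y, (P.map Prod.snd).real {y} :=
        Finset.sum_le_sum fun y _ => ciInf_le (Set.finite_range _).bddBelow y
    _ = 1 := by rw [sum_measureReal_singleton]; simp
    _ ≤ v := hv

end ErrorGap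

lemma ofReal_le_iInf_mainBound_add {Q : Decoder U Y} {δ : ℝ} {n : ℕ} {N : Set ℕ}
    {quant : ∀ K : N, Quantization X Y (K : ℕ)} {g : ℝ} {r : ℝ≥0}
    (h : ∀ K, g ≤ 2 * epsilonK q Q (quant K)
      + (constD (Fintype.card Y) δ Q.minProb * hellinger P q Q (quant K)
        + constC (Fintype.card Y) δ (vol.real Set.univ) (minClassProb P)) / √n + r) :
    ENNReal.ofReal g ≤ (⨅ K, mainBound P q Q δ n (quant K)) + r := by
  rw [ENNReal.iInf_add]
  refine le_iInf fun K => (ENNReal.ofReal_le_ofReal (h K)).trans ?_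
  refine ENNReal.ofReal_add_le.trans ?_
  rw [ENNReal.ofReal_coe_nnreal]
  refine add_le_add_left (ENNReal.ofReal_add_le.trans ?_) _
  exact add_le_add_left le_self_add _

end QuantizedLaw

end Model

end CrossEntropyGap

theorem theorem1_general {X Y U : Type*} [MeasurableSpace X] [MeasurableSpace Y] [Fintype Y]
    [MeasurableSingletonClass Y] [MeasurableSpace U]
    (P : Measure (X × Y)) [IsProbabilityMeasure P] (vol : Measure U) [SFinite vol]
    (δ : ℝ) (hδ : δ ∈ Set.Ioo (0 : ℝ) 1) (C : ℝ)
    (hC : √(Real.log (((Fintype.card Y : ℝ) + 4) / δ)) * √(Fintype.card Y : ℝ)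
      * Real.log (Fintype.card Y) < C) :
    ∃ R : ℕ → ℝ≥0,
      (fun n => (R n : ℝ)) =O[atTop] (fun n : ℕ => Real.log n / n) ∧
      ∀ (q : CrossEntropyGap.Encoder X vol) (Q : CrossEntropyGap.Decoder U Y), 0 < Q.minProb →
      ∀ n : ℕ, 0 < n →
        ENNReal.ofReal (1 - δ) ≤
          Measure.pi (fun _ : Fin n => P)
            {S | ∀ (c : Σ K, CrossEntropyGap.Quantization X Y K),
              CrossEntropyGap.gap P q Q S ≤ 2 * CrossEntropyGap.epsilonK q Q c.2
                + (CrossEntropyGap.constD (Fintype.card Y) δ Q.minProb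
                  * CrossEntropyGap.hellinger P q Q c.2 + C) / √(n : ℝ) + R n} := by
  have hC0 : 0 < C := lt_of_le_of_lt (by positivity) hC
  have hR : ∀ n : ℕ, 0 ≤ CrossEntropyGap.remainderConst (Fintype.card Y) δ C / n := fun n =>
    div_nonneg (CrossEntropyGap.remainderConst_nonneg hδ) n.cast_nonneg
  refine ⟨fun n => ⟨_, hR n⟩, CrossEntropyGap.isBigO_const_div_log_div _, fun q Q hQ n hn => ?_⟩
  rw [ENNReal.ofReal_sub _ hδ.1.le, ENNReal.ofReal_one]
  exact CrossEntropyGap.one_sub_le_measure_forall_le fun c =>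
    CrossEntropyGap.measure_pi_lt_gap_le P q c.2 hδ hC0 hC.le hQ hn

theorem theorem1 {X Y U : Type*} [MeasurableSpace X] [MeasurableSpace Y] [Fintype Y]
    [MeasurableSingletonClass Y] [MeasurableSpace U]
    (P : Measure (X × Y)) [IsProbabilityMeasure P] (hP : 0 < CrossEntropyGap.minClassProb P)
    (vol : Measure U) [IsFiniteMeasure vol] (hvol : 1 ≤ vol Set.univ)
    (δ : ℝ) (hδ : δ ∈ Set.Ioo (0 : ℝ) 1) :
    ∃ R : ℕ → ℝ≥0,
      (fun n => (R n : ℝ)) =O[atTop] (fun n : ℕ => Real.log n / n) ∧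
      ∀ (q : CrossEntropyGap.Encoder X vol) (Q : CrossEntropyGap.Decoder U Y)
        (η : ℝ), 0 < η → η ≤ Q.minProb →
      ∀ (N : Set ℕ) (quant : ∀ K : N, CrossEntropyGap.Quantization X Y (K : ℕ)),
      ∀ n : ℕ, 0 < n →
        ENNReal.ofReal (1 - δ) ≤
          Measure.pi (fun _ : Fin n => P)
            {S | ENNReal.ofReal (CrossEntropyGap.gap P q Q S) ≤
              (⨅ K : N, CrossEntropyGap.mainBound P q Q δ n (quant K)) + (R n : ℝ≥0∞)} := by
  have hvol' : 1 ≤ vol.real Set.univ := by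
    simpa [measureReal_def] using ENNReal.toReal_mono (measure_ne_top vol Set.univ) hvol
  obtain ⟨R, hR, hgap⟩ := theorem1_general P vol δ hδ _ (CrossEntropyGap.lt_constC
    (zero_lt_one.trans_le hvol') (CrossEntropyGap.log_card_le_log_div_minClassProb P hP hvol'))
  exact ⟨R, hR, fun q Q η hη hηQ N quant n hn => (hgap q Q (hη.trans_le hηQ) n hn).trans
    (measure_mono fun S hS =>
      CrossEntropyGap.ofReal_le_iInf_mainBound_add P q fun K => hS ⟨K, quant K⟩)⟩
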